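/- Let $(K,<)$ be a totally ordered field and let $f$ be an exponential on $K$, that is, an isomorphism of ordered groups from $(K,+,0,<)$ onto $(K^{>0},\cdot,1,<)$, where $K^{>0}$ is the set of positive elements. For a field valuation $u$ on $K$ write $R_u$ for its valuation ring, $I_u$ for its valuation ideal, and $Ku=R_u/I_u$ for its residue field; a valuation $u'$ is a coarsening of $u$ if $R_u\subseteq R_{u'}$. The natural valuation $v$ of $K$ sends each nonzero element to its archimedean class, so that $R_v=\{a\in K : |a|\le n \text{ for some } n\in\mathbb N\}$. Let $w$ be a coarsening of $v$ such that $f$ is compatible with $w$, that is, $f(R_w)=\{a\in K : w(a)=0,\ a>0\}$ and $f(I_w)=1+I_w$ (valuations written additively). Then there is no coarsening $\tilde w$ of $w$ such that the valuation $\overline w=w/\tilde w$ induced by $w$ on the residue field $K\tilde w$ (given by $\overline w(b+I_{\tilde w})=w(b)$ for $b\in R_{\tilde w}\setminus I_{\tilde w}$) is nontrivial and the valued field $(K\tilde w,\overline w)$ is maximal, i.e. admits no proper immediate extension (a valued field extension is immediate if it has the same value group and the same residue field). -/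

import Mathlib

open IsLocalRing

/-- An exponential on an ordered field `K`: an isomorphism of the ordered additive group
`(K, +, 0, <)` onto the ordered multiplicative group `(K^{>0}, ·, 1, <)` of positive elements. -/
abbrev OrderedFieldExponential (K : Type*) [Field K] [LinearOrder K] [IsStrictOrderedRing K] :=
  Multiplicative K ≃*o {x : K // 0 < x}

/-- The exponential as a function `K → K`. -/
def OrderedFieldExponential.exp {K : Type*} [Field K] [LinearOrder K] [IsStrictOrderedRing K]
    (f : OrderedFieldExponential K) (a : K) : K :=
  (f (Multiplicative.ofAdd a) : {x : K // 0 < x})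

/-- The natural valuation of an ordered field: `a` is sent to its archimedean class.
(Valuations are written multiplicatively: larger elements have larger values.) -/
noncomputable def naturalValuation (K : Type*) [Field K] [LinearOrder K] [IsStrictOrderedRing K] :
    Valuation K (Multiplicative (ArchimedeanClass K)ᵒᵈ) :=
  (ArchimedeanClass.addValuation K).toValuation

namespace Valuation

/-- `w` is a coarsening of `v`: the valuation ring of `v` is contained in that of `w`. -/
def IsCoarseningOf {K Γ Γ' : Type*} [Field K] [LinearOrderedCommGroupWithZero Γ]
    [LinearOrderedCommGroupWithZero Γ'] (w : Valuation K Γ') (v : Valuation K Γ) : Prop :=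
  v.valuationSubring ≤ w.valuationSubring

/-- `f` is compatible with `w`: `f (R_w)` is the group of positive units of the valuation ring
`R_w`, and `f (I_w) = 1 + I_w`, where `I_w` is the valuation ideal. -/
def IsCompatibleWith {K Γ : Type*} [Field K] [LinearOrder K] [IsStrictOrderedRing K]
    [LinearOrderedCommGroupWithZero Γ] (w : Valuation K Γ) (f : OrderedFieldExponential K) : Prop :=
  f.exp '' {a | w a ≤ 1} = {a | w a = 1 ∧ 0 < a} ∧
    f.exp '' {a | w a < 1} = (fun a => 1 + a) '' {a | w a < 1}

/-- The residue field `Kw` of a valued field `(K, w)`. -/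
abbrev ResField {K Γ : Type*} [Field K] [LinearOrderedCommGroupWithZero Γ] (w : Valuation K Γ) :
    Type _ :=
  ResidueField w.valuationSubring

section Induced

variable {K Γ Γ' : Type*} [Field K] [LinearOrderedCommGroupWithZero Γ]
  [LinearOrderedCommGroupWithZero Γ']

theorem lt_one_of_isCoarseningOf {w : Valuation K Γ} {wt : Valuation K Γ'}
    (h : wt.IsCoarseningOf w) {a : K} (ha : wt a < 1) : w a < 1 := by
  by_contra hc
  have h1 : (1 : Γ) ≤ w a := not_lt.mp hc
  have ha0 : a ≠ 0 := by
    rintro rfl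
    simp at h1
  have h2 : a⁻¹ ∈ wt.valuationSubring := by
    apply h
    rw [Valuation.mem_valuationSubring_iff, map_inv₀]
    exact inv_le_one_of_one_le₀ h1
  rw [Valuation.mem_valuationSubring_iff, map_inv₀] at h2
  have h3 : 0 < wt a := (Valuation.pos_iff wt).mpr ha0
  exact absurd ha (not_lt.mpr ((inv_le_one₀ h3).mp h2))

theorem residue_eq_zero_iff' (wt : Valuation K Γ') (b : wt.valuationSubring) :
    residue wt.valuationSubring b = 0 ↔ wt (b : K) < 1 := by
  rw [residue_eq_zero_iff, mem_maximalIdeal, mem_nonunits_iff]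
  exact Valuation.Integer.not_isUnit_iff_valuation_lt_one

theorem eq_of_residue_eq {w : Valuation K Γ} {wt : Valuation K Γ'} (h : wt.IsCoarseningOf w)
    {b c : wt.valuationSubring} (hb : residue wt.valuationSubring b ≠ 0)
    (hbc : residue wt.valuationSubring b = residue wt.valuationSubring c) :
    w (b : K) = w (c : K) := by
  have h1 : wt (b : K) = 1 :=
    le_antisymm b.2 (not_lt.mp fun hlt => hb ((residue_eq_zero_iff' wt b).mpr hlt))
  have hb0 : (b : K) ≠ 0 := by
    intro h0
    rw [h0, map_zero] at h1
    exact zero_ne_one h1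
  have h2 : wt ((c : K) - b) < 1 := by
    have := (residue_eq_zero_iff' wt (c - b)).mp (by rw [RingHom.map_sub, hbc, sub_self])
    simpa using this
  have h3 : wt (((c : K) - b) / b) < 1 := by rwa [map_div₀, h1, div_one]
  have h4 := lt_one_of_isCoarseningOf h h3
  have h5 : w ((c : K) - b) < w (b : K) := by
    rwa [map_div₀, div_lt_one₀ ((Valuation.pos_iff w).mpr hb0)] at h4
  have h6 := Valuation.map_add_eq_of_lt_right w h5
  rw [sub_add_cancel] at h6
  exact h6.symm

/-- A representative in `R_w` of a residue class in `Kw`. -/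
noncomputable def rep (w : Valuation K Γ) (x : w.ResField) : w.valuationSubring :=
  Function.surjInv (residue_surjective (R := w.valuationSubring)) x

theorem residue_rep (w : Valuation K Γ) (x : w.ResField) :
    residue w.valuationSubring (w.rep x) = x :=
  Function.surjInv_eq _ x

open Classical in
/-- The valuation `w/w̃` induced by `w` on the residue field `Kw̃` of a coarsening `w̃` of `w`:
the residue class of a unit `b` of `R_w̃` has value `w b` (the choice of the representative does
not matter, see `induced_residue`), and `0` has value `0`. -/
noncomputable def induced (w : Valuation K Γ) (wt : Valuation K Γ') (h : wt.IsCoarseningOf w) :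
    Valuation wt.ResField Γ where
  toFun x := if x = 0 then 0 else w (wt.rep x : K)
  map_zero' := by simp
  map_one' := by
    rw [if_neg one_ne_zero, ← map_one w]
    apply eq_of_residue_eq h (c := 1)
    · rw [residue_rep]; exact one_ne_zero
    · rw [residue_rep, map_one]
  map_mul' x y := by
    by_cases hx : x = 0
    · simp [hx]
    by_cases hy : y = 0
    · simp [hy]
    rw [if_neg hx, if_neg hy, if_neg (mul_ne_zero hx hy), ← map_mul]
    refine eq_of_residue_eq h (c := _ * _) ?_ ?_
    · rw [residue_rep]; exact mul_ne_zero hx hy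
    · rw [map_mul, residue_rep, residue_rep, residue_rep]
  map_add_le_max' x y := by
    by_cases hx : x = 0
    · simp [hx]
    by_cases hy : y = 0
    · simp [hy]
    by_cases hxy : x + y = 0
    · simp [hxy]
    rw [if_neg hx, if_neg hy, if_neg hxy]
    refine le_trans (le_of_eq ?_) (Valuation.map_add w _ _)
    refine eq_of_residue_eq h (c := _ + _) ?_ ?_
    · rw [residue_rep]; exact hxy
    · rw [RingHom.map_add, residue_rep, residue_rep, residue_rep]

theorem induced_residue (w : Valuation K Γ) (wt : Valuation K Γ') (h : wt.IsCoarseningOf w)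
    (b : wt.valuationSubring) (hb : residue wt.valuationSubring b ≠ 0) :
    w.induced wt h (residue wt.valuationSubring b) = w (b : K) := by
  classical
  refine (if_neg hb).trans ?_
  apply eq_of_residue_eq h
  · rwa [residue_rep]
  · rw [residue_rep]

end Induced

/-- The extension `(F, v) ⊆ (L, v')` of valued fields is immediate: `v'` extends `v`, every value
of `v'` is the value of an element of `F`, and every residue class of `v'` contains an element
of `F` (that is, the canonical embeddings of value groups and of residue fields are onto). -/
structure IsImmediateExtension {F L Γ Γ' : Type*} [Field F] [Field L] [Algebra F L]
    [LinearOrderedCommGroupWithZero Γ] [LinearOrderedCommGroupWithZero Γ']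
    (v : Valuation F Γ) (v' : Valuation L Γ') : Prop where
  hasExtension : v.HasExtension v'
  value_group : ∀ y : L, ∃ x : F, v' (algebraMap F L x) = v' y
  residue_field : ∀ y : L, v' y ≤ 1 → ∃ x : F, v' (y - algebraMap F L x) < 1

/-- The valued field `(F, v)` is maximal: it admits no proper immediate extension.
(Immediate extensions of `F` have cardinality bounded by that of a power series field over `F`,
so quantifying over the universe of `F` covers all of them up to isomorphism.) -/
def IsMaximalValued.{u, t} {F : Type u} {Γ : Type t} [Field F] [LinearOrderedCommGroupWithZero Γ]
    (v : Valuation F Γ) : Prop :=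
  ∀ (L Γ' : Type u) [Field L] [Algebra F L] [LinearOrderedCommGroupWithZero Γ']
    (v' : Valuation L Γ'),
    v.IsImmediateExtension v' → Function.Surjective (algebraMap F L)

end Valuation

/-! Values are multiplicative, so infinite elements have value > 1. Suppose the induced valuation is
nontrivial and maximal. Nontriviality yields a tower of slowed-down logarithms: exp (x (n+1)) is
infinite, lies in the valuation ring of the coarsening, and has smaller value than x n
(`exists_isLogTower`).

A series is then summed on all levels at once: if S n is the part summed so far, its next term is
exp (x (n+1) - S (n+1)). Since x n dominates S n, terms stay infinite; and adding an infinite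
positive term on level n+1 strictly lowers the value of the next term on level n
(`Continues.exp_lt`). Chains of partial sums are therefore pseudo-Cauchy on each level.

By Kaplansky's argument maximality gives pseudo-limits (`IsMaximalValued.exists_isPseudoLimit`),
which lift to K because the differences are infinite (`exists_isPseudoLimit_of_induced`). So the
summation never stops, against Zorn's lemma (`false_of_forall_chain_exists_rel`). -/

namespace Valuation

open Polynomial Filter

/-! ### Immediate extensions from valuations on F[X] -/

section Extension

universe u t

variable {F : Type u} {Γ : Type t} [Field F] [LinearOrderedCommGroupWithZero Γ]

/-- If every nonzero element of an extension has the same leading term as some element of the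
ground field, then the extension is immediate. -/
theorem IsImmediateExtension.of_forall_exists_sub_lt {L Γ' : Type*} [Field L] [Algebra F L]
    [LinearOrderedCommGroupWithZero Γ'] {v : Valuation F Γ} {v' : Valuation L Γ'}
    (hv : v.HasExtension v')
    (h : ∀ y : L, y ≠ 0 → ∃ c : F, v' (y - algebraMap F L c) < v' y) :
    v.IsImmediateExtension v' where
  hasExtension := hv
  value_group y := by
    rcases eq_or_ne y 0 with rfl | hy
    · exact ⟨0, by simp⟩
    · obtain ⟨c, hc⟩ := h y hy
      refine ⟨c, ?_⟩
      have := v'.map_sub_eq_of_lt_left hc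
      rwa [sub_sub_cancel] at this
  residue_field y hy1 := by
    rcases eq_or_ne y 0 with rfl | hy
    · exact ⟨0, by simp⟩
    · obtain ⟨c, hc⟩ := h y hy
      exact ⟨c, hc.trans_le hy1⟩

/-- A valuation on `F[X]` extending `v`, all of whose values are attained up to smaller terms on
constants, and for which `X` is not congruent to a constant, yields a proper immediate
extension. -/
theorem not_isMaximalValued_of_polynomial {v : Valuation F Γ} (V : Valuation F[X] Γ)
    (hC : ∀ x, V (C x) = v x) (happ : ∀ q, V q ≠ 0 → ∃ c, V (q - C c) < V q)
    (hX : ∀ x, V (X - C x) ≠ 0) : ¬ v.IsMaximalValued := by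
  intro hmax
  -- This treats the transcendental case (zero support) and the algebraic case together.
  let A := F[X] ⧸ V.supp
  let L := FractionRing A
  let V₁ : Valuation A Γ := V.onQuot le_rfl
  have hV₁ (q : F[X]) : V₁ (Ideal.Quotient.mk _ q) = V q := rfl
  have hS : nonZeroDivisors A ≤ V₁.supp.primeCompl := by
    intro a ha
    change a ∉ V₁.supp
    rw [show V₁.supp = 0 from V.supp_quot_supp]
    exact nonZeroDivisors.ne_zero ha
  let W : Valuation L Γ := V₁.extendToLocalization hS L
  let π : F[X] → L := fun q => algebraMap A L (Ideal.Quotient.mk _ q)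
  have hW (q : F[X]) : W (π q) = V q := V₁.extendToLocalization_apply_map_apply hS L _
  have hπ (x : F) : algebraMap F L x = π (C x) := by
    rw [IsScalarTower.algebraMap_apply F A L]; rfl
  have hπsub (q r : F[X]) : π q - π r = π (q - r) := by simp [π]
  have hext : v.HasExtension W := ⟨fun x y => by
    simp only [comap_apply, hπ, hW, hC]⟩
  have happ' (q : F[X]) (hq : π q ≠ 0) : ∃ c : F, W (π q - algebraMap F L c) < W (π q) := by
    obtain ⟨c, hc⟩ := happ q (by rw [← hW]; exact (W.ne_zero_iff).2 hq)
    exact ⟨c, by rwa [hπ, hπsub, hW, hW]⟩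
  have himm : v.IsImmediateExtension W := by
    refine .of_forall_exists_sub_lt hext fun y hy => ?_
    obtain ⟨a, b, hb, rfl⟩ := IsFractionRing.div_surjective (A := A) y
    obtain ⟨q, rfl⟩ := Ideal.Quotient.mk_surjective a
    obtain ⟨r, rfl⟩ := Ideal.Quotient.mk_surjective b
    change π q / π r ≠ 0 at hy
    obtain ⟨hq, hr⟩ := div_ne_zero_iff.1 hy
    obtain ⟨c, hc⟩ := happ' q hq
    obtain ⟨d, hd⟩ := happ' r hr
    refine ⟨c / d, ?_⟩
    change W (π q / π r - _) < W (π q / π r)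
    have hWr : 0 < W (π r) := W.pos_iff.2 hr
    have hdr : W (algebraMap F L d) = W (π r) := by
      have := W.map_sub_eq_of_lt_left hd
      rwa [sub_sub_cancel] at this
    have hd0 : algebraMap F L d ≠ 0 := by
      rw [← W.ne_zero_iff, hdr]; exact hWr.ne'
    have key : π q / π r - algebraMap F L (c / d) =
        ((π q - algebraMap F L c) * π r - π q * (π r - algebraMap F L d)) /
          (π r * algebraMap F L d) := by
      rw [map_div₀, div_sub_div _ _ hr hd0]; congr 1; ring
    rw [key, map_div₀, map_div₀, map_mul, hdr, ← div_div,
      div_lt_div_iff_of_pos_right hWr, div_lt_iff₀ hWr]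
    refine W.map_sub_lt ?_ ?_
    · rw [map_mul]
      exact mul_lt_mul_of_pos_right hc hWr
    · rw [map_mul]
      exact mul_lt_mul_of_pos_left hd (W.pos_iff.2 hq)
  -- Maximality only tests value groups in the universe of `F`, so `W` is replaced by an equivalent
  -- valuation living there.
  have hequiv := W.isEquiv_valuation_valuationSubring
  have himm' : v.IsImmediateExtension W.valuationSubring.valuation :=
    { hasExtension := ⟨hext.val_isEquiv_comap.trans (hequiv.comap _)⟩
      value_group := fun y => (himm.value_group y).imp fun x hx => hequiv.eq_iff.1 hx
      residue_field := fun y hy =>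
        (himm.residue_field y (hequiv.le_one_iff_le_one.2 hy)).imp fun x hx =>
          hequiv.lt_one_iff_lt_one.1 hx }
  obtain ⟨x, hx⟩ := hmax L _ _ himm' (π X)
  apply hX x
  rw [← hW, ← hπsub, ← hπ, hx, sub_self, map_zero]

end Extension

/-! ### Pseudo-Cauchy families and eventual values of polynomials -/

section PseudoCauchy

variable {F Γ ι : Type*} [Field F] [LinearOrderedCommGroupWithZero Γ] [LinearOrder ι]

/-- Pseudo-Cauchy families of elements of a valued field. -/
def IsPseudoCauchy (v : Valuation F Γ) (a : ι → F) : Prop :=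
  ∀ ⦃i j k⦄, i < j → j < k → v (a k - a j) < v (a j - a i)

/-- Pseudo-limits of families of elements of a valued field. -/
def IsPseudoLimit (v : Valuation F Γ) (a : ι → F) (x : F) : Prop :=
  ∀ ⦃i j⦄, i < j → v (x - a i) ≤ v (a j - a i)

/-- The polynomial `q` has value `g` at `a i` for all large `i`. -/
def HasEventualValue (v : Valuation F Γ) (a : ι → F) (q : F[X]) (g : Γ) : Prop :=
  ∀ᶠ i in atTop, v (q.eval (a i)) = g

variable {v : Valuation F Γ} {a : ι → F}

theorem hasEventualValue_C (x : F) : v.HasEventualValue a (C x) (v x) := by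
  simp [HasEventualValue]

theorem HasEventualValue.mul {q r : F[X]} {g h : Γ} (hq : v.HasEventualValue a q g)
    (hr : v.HasEventualValue a r h) : v.HasEventualValue a (q * r) (g * h) := by
  filter_upwards [hq, hr] with i hi hi'
  rw [eval_mul, map_mul, hi, hi']

theorem HasEventualValue.of_mul {q r : F[X]} {g h : Γ} (hqr : v.HasEventualValue a (q * r) g)
    (hr : v.HasEventualValue a r h) (h0 : h ≠ 0) : v.HasEventualValue a q (g / h) := by
  filter_upwards [hqr, hr] with i hi hi'
  rw [eval_mul, map_mul, hi'] at hi
  exact eq_div_of_mul_eq h0 hi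

theorem HasEventualValue.sub {q r : F[X]} {g h : Γ} (hq : v.HasEventualValue a q g)
    (hr : v.HasEventualValue a r h) (hne : g ≠ h) :
    v.HasEventualValue a (q - r) (max g h) := by
  filter_upwards [hq, hr] with i hi hi'
  rw [eval_sub, ← hi, ← hi']
  rw [sub_eq_add_neg, ← v.map_neg (eval _ r)]
  exact v.map_add_of_distinct_val (by rwa [v.map_neg, hi, hi'])

/-- Once some a j is closer to a i than x is, so are all later a k, and x - a k keeps the value of x
- a i. -/
theorem IsPseudoCauchy.exists_hasEventualValue_X_sub_C (ha : v.IsPseudoCauchy a) {x : F}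
    (hx : ¬ v.IsPseudoLimit a x) : ∃ g, v.HasEventualValue a (X - C x) g := by
  simp only [IsPseudoLimit, not_forall, not_le] at hx
  obtain ⟨i, j, hij, hlt⟩ := hx
  refine ⟨v (x - a i), ?_⟩
  filter_upwards [eventually_ge_atTop j] with k hk
  have h1 : v (a k - a i) < v (x - a i) := by
    rcases hk.eq_or_lt with rfl | hk
    · exact hlt
    · refine lt_of_le_of_lt ?_ hlt
      rw [← sub_add_sub_cancel (a k) (a j) (a i)]
      exact v.map_add_le (ha hij hk).le le_rfl
  have := v.map_sub_eq_of_lt_right h1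
  rw [eval_sub, eval_X, eval_C, ← this]
  congr 1; ring

section NoMaxOrder

variable [NoMaxOrder ι]

theorem IsPseudoCauchy.ne (ha : v.IsPseudoCauchy a) {i j : ι} (hij : i < j) : a i ≠ a j := by
  intro h
  obtain ⟨k, hk⟩ := exists_gt j
  have := ha hij hk
  simp [h] at this

theorem IsPseudoCauchy.injective (ha : v.IsPseudoCauchy a) : Function.Injective a := by
  intro i j h
  rcases lt_trichotomy i j with hij | hij | hij
  · exact absurd h (ha.ne hij)
  · exact hij
  · exact absurd h.symm (ha.ne hij)

end NoMaxOrder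

variable [Nonempty ι]

theorem HasEventualValue.unique {q : F[X]} {g h : Γ} (hg : v.HasEventualValue a q g)
    (hh : v.HasEventualValue a q h) : g = h := by
  obtain ⟨i, hi, hi'⟩ := (hg.and hh).exists
  exact hi.symm.trans hi'

theorem HasEventualValue.add_le {q r : F[X]} {g h k : Γ} (hq : v.HasEventualValue a q g)
    (hr : v.HasEventualValue a r h) (hqr : v.HasEventualValue a (q + r) k) : k ≤ max g h := by
  obtain ⟨i, ⟨hi, hi'⟩, hi''⟩ := ((hq.and hr).and hqr).exists
  rw [← hi, ← hi', ← hi'', eval_add]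
  exact v.map_add _ _

variable [NoMaxOrder ι]

theorem HasEventualValue.eq_zero (ha : v.IsPseudoCauchy a) {q : F[X]}
    (hq : v.HasEventualValue a q 0) : q = 0 := by
  obtain ⟨i, hi⟩ := eventually_atTop.1 hq
  refine eq_zero_of_infinite_isRoot q
    (((Set.Ici_infinite i).image ha.injective.injOn).mono ?_)
  rintro _ ⟨j, hj, rfl⟩
  exact v.zero_iff.1 (hi j hj)

/-- Polynomials of degree at most `n` are eventually close to constants, provided that all of them
have eventually constant value. -/
theorem IsPseudoCauchy.exists_eventually_sub_lt (ha : v.IsPseudoCauchy a) (n : ℕ) {q : F[X]}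
    (hq : q.natDegree ≤ n) (h0 : q ≠ 0)
    (h : ∀ r : F[X], r.natDegree ≤ n → ∃ g, v.HasEventualValue a r g) :
    ∃ c, ∀ᶠ i in atTop, v (q.eval (a i) - c) < v (q.eval (a i)) := by
  induction n generalizing q with
  | zero =>
    obtain ⟨c, rfl⟩ := natDegree_eq_zero.1 (Nat.le_zero.1 hq)
    have hc : c ≠ 0 := fun hc => h0 (by simp [hc])
    exact ⟨c, by simp [hc, v.pos_iff]⟩
  | succ n ih =>
    obtain ⟨δ, hδ⟩ := h q hq
    have hδ0 : δ ≠ 0 := fun hh => h0 ((hh ▸ hδ).eq_zero ha)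
    obtain ⟨i, hi⟩ := hδ.exists
    obtain ⟨ε, hε⟩ := h (q - C (q.eval (a i))) (by rwa [natDegree_sub_C])
    have hεδ : ε ≤ δ := by
      obtain ⟨j, hj, hj'⟩ := (hε.and hδ).exists
      rw [← hj, eval_sub, eval_C]
      exact v.map_sub_le hj'.le hi.le
    rcases hεδ.lt_or_eq with hlt | rfl
    · refine ⟨q.eval (a i), ?_⟩
      filter_upwards [hε, hδ] with j hj hj'
      rw [eval_sub, eval_C] at hj
      rwa [hj, hj']
    -- If subtracting q(a i) does not lower the value, approximate the quotient r by a constant c.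
    -- Then q(a j) - q(a i) is (a j - a i) c up to smaller terms; comparing with a fixed k > i shows
    -- that q(a k) is the required constant.
    set r := q /ₘ (X - C (a i)) with hr
    have hqr : q = C (q.eval (a i)) + (X - C (a i)) * r := by
      rw [← modByMonic_X_sub_C_eq_C_eval, modByMonic_add_div]
    have hqr' (x : F) : q.eval x - q.eval (a i) = (x - a i) * r.eval x := by
      conv_lhs => rw [hqr]
      simp
    have hr0 : r ≠ 0 := by
      intro hr0
      obtain ⟨j, hj⟩ := hε.exists
      rw [eval_sub, eval_C, hqr', hr0] at hj
      exact hδ0 (by simpa using hj.symm)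
    have hrn : r.natDegree ≤ n := by
      rw [hr, natDegree_divByMonic _ (monic_X_sub_C _), natDegree_X_sub_C]
      omega
    obtain ⟨c, hc⟩ := ih hrn hr0 fun s hs => h s (hs.trans n.le_succ)
    have hev : ∀ᶠ j in atTop, v (q.eval (a j) - q.eval (a i) - (a j - a i) * c) < ε := by
      filter_upwards [hc, hε, eventually_gt_atTop i] with j hj hj' hij
      rw [eval_sub, eval_C] at hj'
      rw [hqr', ← mul_sub, map_mul, ← hj', hqr', map_mul]
      exact mul_lt_mul_of_pos_left hj (v.pos_iff.2 (sub_ne_zero.2 (ha.ne hij).symm))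
    obtain ⟨k, ⟨⟨hk, hkε⟩, hkc⟩, hik⟩ :=
      (((hev.and hε).and hc).and (eventually_gt_atTop i)).exists
    have hvc : v c = v (r.eval (a k)) := by
      have := v.map_sub_eq_of_lt_left hkc
      rwa [sub_sub_cancel] at this
    have hc0 : 0 < v c := hvc ▸ (zero_le.trans_lt hkc)
    refine ⟨q.eval (a k), ?_⟩
    filter_upwards [hev, hδ, eventually_gt_atTop k] with j hj hj' hkj
    rw [hj']
    have : q.eval (a j) - q.eval (a k) =
        (q.eval (a j) - q.eval (a i) - (a j - a i) * c) -
        (q.eval (a k) - q.eval (a i) - (a k - a i) * c) + (a j - a k) * c := by ring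
    rw [this]
    refine v.map_add_lt (v.map_sub_lt hj hk) ?_
    rw [eval_sub, eval_C, hqr', map_mul, ← hvc] at hkε
    rw [map_mul, ← hkε]
    exact mul_lt_mul_of_pos_right (ha hik hkj) hc0

end PseudoCauchy

end Valuation

namespace Valuation

open Polynomial Filter

/-! ### Kaplansky: maximal fields have pseudo-limits -/

section EventualValuation

/-- Take p of least degree without eventual value, so that remainders have one; if there is none,
take p = 0, as q % 0 = q. -/
theorem exists_reducing_polynomial {F Γ ι : Type*} [Field F] [LinearOrderedCommGroupWithZero Γ]
    [LinearOrder ι] [Nonempty ι] (v : Valuation F Γ) (a : ι → F) :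
    ∃ p : F[X], (∀ q : F[X], ∃ g, v.HasEventualValue a (q % p) g) ∧
      (p ≠ 0 → ∀ g, ¬ v.HasEventualValue a p g) := by
  by_cases h : ∀ q : F[X], ∃ g, v.HasEventualValue a q g
  · exact ⟨0, by simpa using h, by simp⟩
  · push Not at h
    obtain ⟨p, hp, hmin⟩ := (InvImage.wf (degree (R := F)) wellFounded_lt).has_min
      {q : F[X] | ∀ g, ¬ v.HasEventualValue a q g} h
    have hp0 : p ≠ 0 := by
      rintro rfl
      exact hp 0 (by simp [HasEventualValue])
    refine ⟨p, fun q => ?_, fun _ => hp⟩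
    by_contra hc
    exact hmin _ (not_exists.1 hc) (degree_mod_lt q hp0)

variable {F Γ ι : Type*} [Field F] [LinearOrderedCommGroupWithZero Γ] [LinearOrder ι]
  [Nonempty ι] [NoMaxOrder ι] {v : Valuation F Γ} {a : ι → F}

/-- The valuation of `F[X]` sending `q` to the eventual value of its remainder modulo `p`, where
`p` is a polynomial of least degree without an eventual value, or `0` if there is none. -/
noncomputable def eventualValuation (ha : v.IsPseudoCauchy a) (p : F[X])
    (hred : ∀ q : F[X], ∃ g, v.HasEventualValue a (q % p) g)
    (hp : p ≠ 0 → ∀ g, ¬ v.HasEventualValue a p g) : Valuation F[X] Γ where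
  toFun q := (hred q).choose
  map_zero' := (hred 0).choose_spec.unique (by simpa using hasEventualValue_C (v := v) (a := a) 0)
  map_one' := by
    refine (hred 1).choose_spec.unique ?_
    have h1 : v.HasEventualValue a 1 1 := by simpa using hasEventualValue_C (v := v) (a := a) 1
    rcases eq_or_ne p 0 with rfl | h0
    · simpa using h1
    rwa [(mod_eq_self_iff h0).2]
    rw [degree_one]
    by_contra hc
    rw [eq_C_of_degree_le_zero (not_lt.1 hc)] at hp h0
    exact hp h0 _ (hasEventualValue_C _)
  map_mul' q r := by
    have hq := (hred q).choose_spec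
    have hr := (hred r).choose_spec
    have ht := (hred (q * r)).choose_spec
    -- If the values differed, the nonzero multiple p * s would have an eventual value; so does s,
    -- of smaller degree than p, and dividing would give one to p.
    by_contra hne
    have hmul := hq.mul hr
    rcases eq_or_ne p 0 with rfl | h0
    · simp only [EuclideanDomain.mod_zero] at *
      exact hne (ht.unique hmul)
    set s := (q % p * (r % p)) / p with hs
    have hps : q % p * (r % p) - (q * r) % p = p * s := by
      rw [mul_mod, sub_eq_iff_eq_add, EuclideanDomain.div_add_mod]
    have hval := hmul.sub ht (Ne.symm hne)
    rw [hps] at hval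
    have hs0 : s ≠ 0 := by
      intro h
      rw [h, mul_zero, sub_eq_zero] at hps
      rw [hps] at hmul
      exact hne (ht.unique hmul)
    have hlt (x : F[X]) : (x % p).degree < p.degree := degree_mod_lt x h0
    have hsp : s % p = s := by
      rw [mod_eq_self_iff h0]
      have hltn (x : F[X]) : (x % p).natDegree < p.natDegree :=
        natDegree_mod_lt x fun h => hp h0 _ (by
          rw [eq_C_of_natDegree_eq_zero h]
          exact hasEventualValue_C _)
      have hdeg := natDegree_mul h0 hs0
      rw [← hps] at hdeg
      have h2 := natDegree_sub_le (q % p * (r % p)) (q * r % p)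
      have h3 := natDegree_mul_le (p := q % p) (q := r % p)
      have h4 := hltn q
      have h5 := hltn r
      have h6 := hltn (q * r)
      rw [degree_eq_natDegree hs0, degree_eq_natDegree h0, Nat.cast_lt]
      omega
    obtain ⟨σ, hσ⟩ := hred s
    rw [hsp] at hσ
    exact hp h0 _ (hval.of_mul hσ fun h => hs0 ((h ▸ hσ).eq_zero ha))
  map_add_le_max' q r := by
    refine (hred q).choose_spec.add_le (hred r).choose_spec ?_
    rw [← add_mod]
    exact (hred (q + r)).choose_spec

theorem eventualValuation_eq (ha : v.IsPseudoCauchy a) {p : F[X]}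
    (hred : ∀ q : F[X], ∃ g, v.HasEventualValue a (q % p) g)
    (hp : p ≠ 0 → ∀ g, ¬ v.HasEventualValue a p g) {q : F[X]} {g : Γ}
    (hq : v.HasEventualValue a (q % p) g) : eventualValuation ha p hred hp q = g :=
  (hred q).choose_spec.unique hq

theorem hasEventualValue_eventualValuation (ha : v.IsPseudoCauchy a) {p : F[X]}
    (hred : ∀ q : F[X], ∃ g, v.HasEventualValue a (q % p) g)
    (hp : p ≠ 0 → ∀ g, ¬ v.HasEventualValue a p g) (q : F[X]) :
    v.HasEventualValue a (q % p) (eventualValuation ha p hred hp q) :=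
  (hred q).choose_spec

/-- In a maximal valued field every pseudo-Cauchy family has a pseudo-limit. -/
theorem IsMaximalValued.exists_isPseudoLimit (hv : v.IsMaximalValued) (ha : v.IsPseudoCauchy a) :
    ∃ x, v.IsPseudoLimit a x := by
  by_contra! hno
  obtain ⟨p, hred, hp⟩ := exists_reducing_polynomial v a
  let V := eventualValuation ha p hred hp
  have hV (q : F[X]) : v.HasEventualValue a (q % p) (V q) :=
    hasEventualValue_eventualValuation ha hred hp q
  have hself (q : F[X]) (hq : p ≠ 0 → q.degree < p.degree) : q % p = q := by
    rcases eq_or_ne p 0 with rfl | h0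
    · simp
    · exact (mod_eq_self_iff h0).2 (hq h0)
  refine not_isMaximalValued_of_polynomial V (fun x => ?_) (fun q hq => ?_) (fun x hx => ?_) hv
  · refine eventualValuation_eq ha hred hp ?_
    rw [hself]
    · exact hasEventualValue_C x
    · intro h0
      refine degree_C_le.trans_lt ?_
      by_contra hc
      rw [eq_C_of_degree_le_zero (not_lt.1 hc)] at hp h0
      exact hp h0 _ (hasEventualValue_C _)
  · have hq0 : q % p ≠ 0 := by
      intro h
      refine hq (eventualValuation_eq ha hred hp ?_)
      rw [h]
      simp [HasEventualValue]
    have hdeg (r : F[X]) (hr : r.natDegree ≤ (q % p).natDegree) : r % p = r := by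
      refine hself r fun h0 => lt_of_le_of_lt ?_ (degree_mod_lt q h0)
      rw [degree_eq_natDegree hq0]
      exact degree_le_of_natDegree_le hr
    obtain ⟨c, hc⟩ := ha.exists_eventually_sub_lt _ le_rfl hq0 fun r hr => by
      simpa only [hdeg r hr] using hred r
    refine ⟨c, ?_⟩
    have hqc : (q - C c) % p = q % p - C c := by
      rw [sub_mod, hdeg (C c) (by simp)]
    obtain ⟨i, ⟨hi, hi'⟩, hi''⟩ := (((hV q).and (hV (q - C c))).and hc).exists
    rw [hqc, eval_sub, eval_C] at hi'
    rwa [← hi, ← hi']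
  · have h0 := (hx ▸ hV (X - C x)).eq_zero ha
    obtain ⟨g, hg⟩ := ha.exists_hasEventualValue_X_sub_C (hno x)
    obtain ⟨s, hs⟩ := EuclideanDomain.mod_eq_zero.1 h0
    have hp0 : p ≠ 0 := by
      rintro rfl
      exact X_sub_C_ne_zero x (by simpa using hs)
    rcases (irreducible_X_sub_C x).isUnit_or_isUnit hs with h | h
    · obtain ⟨r, -, rfl⟩ := isUnit_iff.1 h
      exact hp hp0 _ (hasEventualValue_C r)
    · obtain ⟨r, hr, rfl⟩ := isUnit_iff.1 h
      rw [hs] at hg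
      exact hp hp0 _ (hg.of_mul (hasEventualValue_C r) (v.ne_zero_iff.2 hr.ne_zero))

end EventualValuation

end Valuation

/-! ### Zorn's lemma for strict orders -/

/-- A nonempty type does not carry a strict order in which every element has a successor and every
nonempty strictly increasing family without last element has a strict upper bound. -/
theorem false_of_forall_chain_exists_rel {X : Type*} [Nonempty X] {r : X → X → Prop}
    (htrans : ∀ {x y z}, r x y → r y z → r x z) (hirrefl : ∀ x, ¬ r x x)
    (hsucc : ∀ x, ∃ y, r x y)
    (hlim : ∀ (c : Set X) [LinearOrder c] [Nonempty c] [NoMaxOrder c],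
      (∀ ⦃x y : c⦄, x < y → r x y) → ∃ u, ∀ x : c, r x u) : False := by
  classical
  suffices h : ∀ c : Set X, IsChain r c → ∃ u, ∀ x ∈ c, r x u by
    obtain ⟨m, hm⟩ := exists_maximal_of_chains_bounded h htrans
    obtain ⟨y, hy⟩ := hsucc m
    exact hirrefl _ (htrans hy (hm y hy))
  intro c hc
  rcases c.eq_empty_or_nonempty with rfl | hne
  · exact ⟨Classical.arbitrary X, by simp⟩
  by_cases h : ∀ x ∈ c, ∃ y ∈ c, r x y
  · have : IsStrictTotalOrder c fun x y => r x y :=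
      { trichotomous := fun x y h h' => by
          by_contra hxy
          exact (hc x.2 y.2 (Subtype.coe_injective.ne hxy)).elim h h'
        irrefl := fun x => hirrefl x
        trans := fun _ _ _ => htrans }
    let : LinearOrder c := linearOrderOfSTO fun x y : c => r x y
    have : Nonempty c := hne.to_subtype
    have : NoMaxOrder c := ⟨fun x => by
      obtain ⟨y, hy, hxy⟩ := h x x.2
      exact ⟨⟨y, hy⟩, hxy⟩⟩
    obtain ⟨u, hu⟩ := hlim c fun x y hxy => hxy
    exact ⟨u, fun x hx => hu ⟨x, hx⟩⟩
  · push Not at h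
    obtain ⟨x, hx, hmax⟩ := h
    obtain ⟨u, hu⟩ := hsucc x
    refine ⟨u, fun y hy => ?_⟩
    rcases eq_or_ne x y with rfl | hxy
    · exact hu
    · exact htrans ((hc hx hy hxy).resolve_left (hmax y hy)) hu

/-! ### The exponential and convex valuations -/

namespace OrderedFieldExponential

variable {K : Type*} [Field K] [LinearOrder K] [IsStrictOrderedRing K]
  (f : OrderedFieldExponential K)

theorem exp_pos (a : K) : 0 < f.exp a := (f (Multiplicative.ofAdd a)).2

theorem exp_add (a b : K) : f.exp (a + b) = f.exp a * f.exp b := by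
  simp [exp, ofAdd_add]

theorem exp_zero : f.exp 0 = 1 := by
  simp [exp]

theorem exp_le_exp {a b : K} : f.exp a ≤ f.exp b ↔ a ≤ b := by
  rw [exp, exp, Subtype.coe_le_coe, map_le_map_iff, Multiplicative.ofAdd_le]

theorem exp_lt_exp {a b : K} : f.exp a < f.exp b ↔ a < b :=
  lt_iff_lt_of_le_iff_le f.exp_le_exp

theorem exp_injective : Function.Injective f.exp :=
  StrictMono.injective fun _ _ => f.exp_lt_exp.2

theorem exists_exp_eq {b : K} (hb : 0 < b) : ∃ a, f.exp a = b := by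
  obtain ⟨a, ha⟩ := f.surjective ⟨b, hb⟩
  exact ⟨a.toAdd, congrArg Subtype.val ha⟩

end OrderedFieldExponential

namespace Valuation

section Ordered

variable {K Γ : Type*} [Field K] [LinearOrder K] [IsStrictOrderedRing K]
    [LinearOrderedCommGroupWithZero Γ] {w : Valuation K Γ}

theorem IsCoarseningOf.le_of_abs_le (hw : w.IsCoarseningOf (naturalValuation K)) {a b : K}
    (h : |a| ≤ |b|) : w a ≤ w b := by
  rcases eq_or_ne b 0 with rfl | hb
  · simp_all
  have hab : a / b ∈ w.valuationSubring := by
    refine hw ?_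
    rw [mem_valuationSubring_iff, ← map_one (naturalValuation K)]
    -- The order is reversed in passing to multiplicative notation.
    change ArchimedeanClass.mk 1 ≤ ArchimedeanClass.mk (a / b)
    refine ArchimedeanClass.mk_le_mk_of_abs ?_
    rw [abs_one, abs_div]
    exact div_le_one_of_le₀ h (abs_nonneg _)
  rwa [mem_valuationSubring_iff, map_div₀, div_le_one₀ (w.pos_iff.2 hb)] at hab

theorem IsCoarseningOf.pos_of_sub_lt (hw : w.IsCoarseningOf (naturalValuation K)) {a b : K}
    (ha : 0 < a) (h : w (b - a) < w a) : 0 < b := by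
  by_contra! hb
  refine h.not_ge (hw.le_of_abs_le ?_)
  rw [abs_of_pos ha, abs_of_neg (by linarith)]
  linarith

/-- By compatibility a positive unit of R_w is the exponential of an element of R_w, which `a` is
not. -/
theorem IsCompatibleWith.one_lt_exp {f : OrderedFieldExponential K} (hf : w.IsCompatibleWith f)
    (hw : w.IsCoarseningOf (naturalValuation K)) {a : K} (ha : 0 < a) (hwa : 1 < w a) :
    1 < w (f.exp a) := by
  refine lt_of_le_of_ne ?_ fun h => ?_
  · rw [← map_one w, ← f.exp_zero]
    refine hw.le_of_abs_le ?_
    rw [abs_of_pos (f.exp_pos _), abs_of_pos (f.exp_pos _), f.exp_le_exp]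
    exact ha.le
  · obtain ⟨b, hb, hba⟩ := hf.1.ge
      (show f.exp a ∈ {a | w a = 1 ∧ 0 < a} from ⟨h.symm, f.exp_pos a⟩)
    rw [f.exp_injective hba] at hb
    exact hwa.not_ge hb

theorem IsCompatibleWith.exp_lt_exp {f : OrderedFieldExponential K} (hf : w.IsCompatibleWith f)
    (hw : w.IsCoarseningOf (naturalValuation K)) {a b : K} (hab : 0 < b - a)
    (hwa : 1 < w (b - a)) : w (f.exp a) < w (f.exp b) := by
  rw [← sub_add_cancel b a, f.exp_add, map_mul]
  exact lt_mul_of_one_lt_left (w.pos_iff.2 (f.exp_pos a).ne') (hf.one_lt_exp hw hab hwa)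

/-- Given infinite positive elements `a` and `b`, with `a` in `R_w̃`, there is an infinite positive
element of `R_w̃` of smaller value than `b`. -/
theorem exists_one_lt_lt (f : OrderedFieldExponential K)
    {Γt : Type*} [LinearOrderedCommGroupWithZero Γt] {wt : Valuation K Γt}
    (hw : w.IsCoarseningOf (naturalValuation K)) (hwt : wt.IsCoarseningOf w)
    {a b : K} (ha : 0 < a) (hwa : 1 < w a) (hta : wt a ≤ 1) (hb : 0 < b) (hwb : 1 < w b) :
    ∃ d, 0 < d ∧ 1 < w d ∧ wt d ≤ 1 ∧ w d < w b := by
  obtain ⟨u, hu, hwu, htu, hub⟩ : ∃ u, 0 < u ∧ 1 < w u ∧ wt u ≤ 1 ∧ w u ≤ w b := by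
    rcases le_total a b with hab | hab
    · exact ⟨a, ha, hwa, hta, hw.le_of_abs_le (by rwa [abs_of_pos ha, abs_of_pos hb])⟩
    · refine ⟨b, hb, hwb, ?_, le_rfl⟩
      have : b / a ∈ wt.valuationSubring := by
        refine hwt ?_
        rw [mem_valuationSubring_iff, map_div₀, div_le_one₀ (w.pos_iff.2 ha.ne')]
        exact hw.le_of_abs_le (by rwa [abs_of_pos ha, abs_of_pos hb])
      rw [mem_valuationSubring_iff, map_div₀, div_le_one₀ (wt.pos_iff.2 ha.ne')] at this
      exact this.trans hta
  obtain ⟨l, rfl⟩ := f.exists_exp_eq hu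
  -- The witness is the square root of u: still infinite, but of strictly smaller value.
  have hl : f.exp l = f.exp (l / 2) ^ 2 := by rw [sq, ← f.exp_add, add_halves]
  rw [hl, map_pow] at hwu hub htu
  have h1 : 1 < w (f.exp (l / 2)) := (one_lt_pow_iff two_ne_zero).1 hwu
  refine ⟨_, f.exp_pos (l / 2), h1, (pow_le_one_iff two_ne_zero).1 htu, lt_of_lt_of_le ?_ hub⟩
  exact lt_self_pow₀ h1 one_lt_two

end Ordered

/-! ### Lifting pseudo-limits from the residue field -/

theorem exists_isPseudoLimit_of_induced {K Γ Γt ι : Type*} [Field K]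
    [LinearOrderedCommGroupWithZero Γ] [LinearOrderedCommGroupWithZero Γt]
    [LinearOrder ι] [Nonempty ι] [NoMaxOrder ι] {w : Valuation K Γ} {wt : Valuation K Γt}
    (hwt : wt.IsCoarseningOf w) (hmax : (w.induced wt hwt).IsMaximalValued) {a : ι → K}
    (hat : ∀ i, wt (a i) ≤ 1) (ha : w.IsPseudoCauchy a)
    (hone : ∀ ⦃i j⦄, i < j → 1 ≤ w (a j - a i)) : ∃ x, w.IsPseudoLimit a x := by
  let b : ι → wt.valuationSubring := fun i => ⟨a i, hat i⟩
  have hne (c : wt.valuationSubring) (hc : 1 ≤ w (c : K)) : residue wt.valuationSubring c ≠ 0 := by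
    rw [Ne, residue_eq_zero_iff']
    exact fun h => hc.not_gt (lt_one_of_isCoarseningOf hwt h)
  have hind (c : wt.valuationSubring) (hc : 1 ≤ w (c : K)) :
      w.induced wt hwt (residue wt.valuationSubring c) = w (c : K) :=
    induced_residue w wt hwt c (hne c hc)
  have hb : (w.induced wt hwt).IsPseudoCauchy fun i => residue wt.valuationSubring (b i) := by
    intro i j k hij hjk
    rw [← RingHom.map_sub, ← RingHom.map_sub, hind (b k - b j) (hone hjk),
      hind (b j - b i) (hone hij)]
    exact ha hij hjk
  obtain ⟨y, hy⟩ := hmax.exists_isPseudoLimit hb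
  obtain ⟨x, rfl⟩ := residue_surjective y
  refine ⟨x, fun i j hij => ?_⟩
  have := hy hij
  rw [← RingHom.map_sub, ← RingHom.map_sub, hind (b j - b i) (hone hij)] at this
  -- The residue map may lose values below 1, but then the bound by a difference of value at least 1
  -- is automatic.
  by_cases hx : 1 ≤ w (x - a i)
  · rwa [hind (x - b i) hx] at this
  · exact (not_le.1 hx).le.trans (hone hij)

end Valuation

namespace Valuation

theorem val_abs {K Γ : Type*} [Field K] [LinearOrder K] [LinearOrderedCommGroupWithZero Γ]
    (w : Valuation K Γ) (a : K) : w |a| = w a := by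
  rcases abs_choice a with h | h <;> rw [h]
  exact w.map_neg a

/-! ### Logarithm towers and simultaneous summation -/

section Tower

variable {K Γ Γt : Type*} [Field K] [LinearOrder K] [IsStrictOrderedRing K]
  [LinearOrderedCommGroupWithZero Γ] [LinearOrderedCommGroupWithZero Γt]
  {f : OrderedFieldExponential K} {w : Valuation K Γ} {wt : Valuation K Γt}

theorem exists_log (hw : w.IsCoarseningOf (naturalValuation K)) (hf : w.IsCompatibleWith f) {d : K}
    (hd : 0 < d) (hwd : 1 < w d) : ∃ x, f.exp x = d ∧ 0 < x ∧ 1 < w x := by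
  obtain ⟨x, rfl⟩ := f.exists_exp_eq hd
  refine ⟨x, rfl, ?_, ?_⟩
  · by_contra! hx
    refine hwd.not_ge ?_
    rw [← map_one w, ← f.exp_zero]
    refine hw.le_of_abs_le ?_
    rwa [abs_of_pos (f.exp_pos _), abs_of_pos (f.exp_pos _), f.exp_le_exp]
  · by_contra! hx
    exact hwd.ne' (hf.1.le (Set.mem_image_of_mem _ hx)).1

/-- A sequence of iterated logarithms of a positive element of `R_w̃` which is infinite with respect
to `w`, slowed down such that it stays in the range of the induced valuation. -/
structure IsLogTower (f : OrderedFieldExponential K) (w : Valuation K Γ) (wt : Valuation K Γt)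
    (x : ℕ → K) : Prop where
  pos : ∀ n, 0 < x n
  one_lt : ∀ n, 1 < w (x n)
  le_one : ∀ n, wt (f.exp (x n)) ≤ 1
  exp_lt : ∀ n, w (f.exp (x (n + 1))) < w (x n)

theorem exists_isLogTower (hw : w.IsCoarseningOf (naturalValuation K)) (hf : w.IsCompatibleWith f)
    (hwt : wt.IsCoarseningOf w) (hnt : (w.induced wt hwt).IsNontrivial) :
    ∃ x, IsLogTower f w wt x := by
  obtain ⟨b, hwb, htb⟩ : ∃ b, 1 < w b ∧ wt b ≤ 1 := by
    obtain ⟨y, hy0, hy1⟩ := hnt.exists_val_nontrivial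
    obtain ⟨b, rfl⟩ := residue_surjective y
    have hb0 : residue wt.valuationSubring b ≠ 0 := by
      intro h
      rw [h, map_zero] at hy0
      exact hy0 rfl
    rw [induced_residue w wt hwt b hb0] at hy0 hy1
    rcases hy1.lt_or_gt with h | h
    · refine ⟨(b : K)⁻¹, ?_, ?_⟩
      · rw [map_inv₀]
        exact (one_lt_inv₀ (zero_lt_iff.2 hy0)).2 h
      · rw [Ne, residue_eq_zero_iff', not_lt] at hb0
        rw [map_inv₀]
        exact inv_le_one_of_one_le₀ hb0
    · exact ⟨b, h, b.2⟩
  have hb : 0 < |b| := abs_pos.2 fun h => by simp [h] at hwb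
  obtain ⟨x₀, hx₀, hpos₀, hone₀⟩ := exists_log hw hf hb (by rwa [val_abs])
  let X := {x : K // 0 < x ∧ 1 < w x ∧ wt (f.exp x) ≤ 1}
  have hstep (x : X) : ∃ y : X, w (f.exp y) < w x := by
    obtain ⟨x, hx, hwx, htx⟩ := x
    -- The next level is the logarithm not of x but of a smaller infinite d, which secures the
    -- strict drop in value.
    obtain ⟨d, hd, hwd, htd, hlt⟩ :=
      exists_one_lt_lt f hw hwt (f.exp_pos x) (hf.one_lt_exp hw hx hwx) htx hx hwx
    obtain ⟨y, rfl, hy, hwy⟩ := exists_log hw hf hd hwd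
    exact ⟨⟨y, hy, hwy, htd⟩, hlt⟩
  choose g hg using hstep
  let x : ℕ → X := fun n => g^[n] ⟨x₀, hpos₀, hone₀, by rw [hx₀, val_abs]; exact htb⟩
  refine ⟨fun n => x n, fun n => (x n).2.1, fun n => (x n).2.2.1, fun n => (x n).2.2.2, fun n => ?_⟩
  have : x (n + 1) = g (x n) := Function.iterate_succ_apply' _ _ _
  rw [this]
  exact hg _

/-- The simultaneous partial sums, one below each level of a tower of logarithms. -/
def IsPartialSum (f : OrderedFieldExponential K) (w : Valuation K Γ) (x S : ℕ → K) : Prop :=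
  ∀ n, w (S n) ≤ w (f.exp (x (n + 1))) ∧ w (f.exp (x n - S n)) ≤ w (f.exp (x n))

/-- The next term of the series with partial sum `S n` is the exponential of the corresponding
element at the next level; `T` continues `S` if `T n` agrees with `S n` up to and including this
next term, for all `n`. -/
def Continues (f : OrderedFieldExponential K) (w : Valuation K Γ) (x S T : ℕ → K) : Prop :=
  ∀ n, w (T n - S n - f.exp (x (n + 1) - S (n + 1))) < w (f.exp (x (n + 1) - S (n + 1)))

variable {x S T : ℕ → K}

theorem Continues.val_sub (h : Continues f w x S T) (n : ℕ) :
    w (T n - S n) = w (f.exp (x (n + 1) - S (n + 1))) := by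
  have := w.map_add_eq_of_lt_right (h n)
  rwa [sub_add_cancel] at this

theorem Continues.sub_pos (hw : w.IsCoarseningOf (naturalValuation K))
    (h : Continues f w x S T) (n : ℕ) : 0 < T n - S n :=
  hw.pos_of_sub_lt (f.exp_pos _) (h n)

theorem IsPartialSum.sub_pos (hw : w.IsCoarseningOf (naturalValuation K))
    (hx : IsLogTower f w wt x) (hS : IsPartialSum f w x S) (n : ℕ) : 0 < x n - S n := by
  refine hw.pos_of_sub_lt (hx.pos n) ?_
  rw [sub_sub_cancel_left, w.map_neg]
  exact (hS n).1.trans_lt (hx.exp_lt n)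

theorem IsPartialSum.one_lt_exp (hw : w.IsCoarseningOf (naturalValuation K))
    (hf : w.IsCompatibleWith f) (hx : IsLogTower f w wt x) (hS : IsPartialSum f w x S) (n : ℕ) :
    1 < w (f.exp (x n - S n)) := by
  refine hf.one_lt_exp hw (hS.sub_pos hw hx n) ?_
  rw [w.map_sub_eq_of_lt_left ((hS n).1.trans_lt (hx.exp_lt n))]
  exact hx.one_lt n

/-- The increment T n - S n is positive and, like its leading term, infinite; removing it from the
exponent lowers the value. -/
theorem Continues.exp_lt (hw : w.IsCoarseningOf (naturalValuation K))
    (hf : w.IsCompatibleWith f) (hx : IsLogTower f w wt x) (hS : IsPartialSum f w x S)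
    (h : Continues f w x S T) (n : ℕ) : w (f.exp (x n - T n)) < w (f.exp (x n - S n)) := by
  have : x n - S n - (x n - T n) = T n - S n := by ring
  refine hf.exp_lt_exp hw ?_ ?_ <;> rw [this]
  · exact h.sub_pos hw n
  · rw [h.val_sub]
    exact hS.one_lt_exp hw hf hx _

theorem Continues.isPartialSum (hw : w.IsCoarseningOf (naturalValuation K))
    (hf : w.IsCompatibleWith f) (hx : IsLogTower f w wt x) (hS : IsPartialSum f w x S)
    (h : Continues f w x S T) : IsPartialSum f w x T := by
  refine fun n => ⟨?_, (h.exp_lt hw hf hx hS n).le.trans (hS n).2⟩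
  rw [← sub_add_cancel (T n) (S n)]
  exact w.map_add_le ((h.val_sub n).trans_le (hS (n + 1)).2) (hS n).1

theorem Continues.of_sub_lt (h : Continues f w x S T) {U : ℕ → K}
    (hU : ∀ n, w (U n - T n) < w (f.exp (x (n + 1) - S (n + 1)))) : Continues f w x S U := by
  intro n
  rw [← sub_add_sub_cancel (U n) (T n) (S n), add_sub_assoc]
  exact w.map_add_lt (hU n) (h n)

theorem Continues.trans (hw : w.IsCoarseningOf (naturalValuation K))
    (hf : w.IsCompatibleWith f) (hx : IsLogTower f w wt x) (hS : IsPartialSum f w x S)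
    (h : Continues f w x S T) {U : ℕ → K} (h' : Continues f w x T U) : Continues f w x S U :=
  h.of_sub_lt fun n => (h'.val_sub n).trans_lt (h.exp_lt hw hf hx hS (n + 1))

theorem Continues.irrefl (S : ℕ → K) : ¬ Continues f w x S S := by
  intro h
  have := h 0
  rw [sub_self, zero_sub, w.map_neg] at this
  exact this.false

theorem continues_add_exp (S : ℕ → K) :
    Continues f w x S fun n => S n + f.exp (x (n + 1) - S (n + 1)) := by
  intro n
  rw [add_sub_cancel_left, sub_self, map_zero]
  exact w.pos_iff.2 (f.exp_pos _).ne'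

theorem IsPartialSum.le_one (hwt : wt.IsCoarseningOf w) (hx : IsLogTower f w wt x)
    (hS : IsPartialSum f w x S) (n : ℕ) : wt (S n) ≤ 1 := by
  have h0 := (f.exp_pos (x (n + 1))).ne'
  have : S n / f.exp (x (n + 1)) ∈ wt.valuationSubring := by
    refine hwt ?_
    rw [mem_valuationSubring_iff, map_div₀, div_le_one₀ (w.pos_iff.2 h0)]
    exact (hS n).1
  rw [mem_valuationSubring_iff, map_div₀, div_le_one₀ (wt.pos_iff.2 h0)] at this
  exact this.trans (hx.le_one _)

/-- Chains of partial sums without last element have a limit. -/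
theorem IsPartialSum.exists_continues (hw : w.IsCoarseningOf (naturalValuation K))
    (hf : w.IsCompatibleWith f) (hwt : wt.IsCoarseningOf w)
    (hmax : (w.induced wt hwt).IsMaximalValued) (hx : IsLogTower f w wt x)
    {ι : Type*} [LinearOrder ι] [Nonempty ι] [NoMaxOrder ι] {S : ι → ℕ → K}
    (hS : ∀ i, IsPartialSum f w x (S i)) (h : ∀ ⦃i j⦄, i < j → Continues f w x (S i) (S j)) :
    ∃ T, ∀ i, Continues f w x (S i) T := by
  have hlim (n : ℕ) : ∃ y, w.IsPseudoLimit (fun i => S i n) y := by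
    refine exists_isPseudoLimit_of_induced hwt hmax (fun i => (hS i).le_one hwt hx n)
      (fun i j k hij hjk => ?_) (fun i j hij => ?_)
    · rw [(h hij).val_sub, (h hjk).val_sub]
      exact (h hij).exp_lt hw hf hx (hS i) _
    · rw [(h hij).val_sub]
      exact ((hS i).one_lt_exp hw hf hx _).le
  choose T hT using hlim
  refine ⟨T, fun i => ?_⟩
  -- T n agrees with S j n only up to the value of the next term after S j; passing from i to j
  -- makes this smaller than the next term after S i.
  obtain ⟨j, hij⟩ := exists_gt i
  obtain ⟨k, hjk⟩ := exists_gt j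
  refine (h hij).of_sub_lt fun n => (hT n hjk).trans_lt ?_
  rw [(h hjk).val_sub]
  exact (h hij).exp_lt hw hf hx (hS i) _

end Tower

end Valuation

/-! ### Contradiction from endless summation -/

theorem mainTheorem4 {K Γ : Type*} [Field K] [LinearOrder K] [IsStrictOrderedRing K]
    [LinearOrderedCommGroupWithZero Γ]
    (f : OrderedFieldExponential K)
    (w : Valuation K Γ) (hw : w.IsCoarseningOf (naturalValuation K))
    (hf : w.IsCompatibleWith f)
    {Γt : Type*} [LinearOrderedCommGroupWithZero Γt]
    (wt : Valuation K Γt) (hwt : wt.IsCoarseningOf w) :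
    ¬ ((w.induced wt hwt).IsNontrivial ∧ (w.induced wt hwt).IsMaximalValued) := by
  rintro ⟨hnt, hmax⟩
  obtain ⟨x, hx⟩ := Valuation.exists_isLogTower hw hf hwt hnt
  let X := {S : ℕ → K // Valuation.IsPartialSum f w x S}
  let r : X → X → Prop := fun S T => Valuation.Continues f w x S.1 T.1
  have htrans {S T U : X} (h : r S T) (h' : r T U) : r S U :=
    Valuation.Continues.trans hw hf hx S.2 h h'
  have hirrefl (S : X) : ¬ r S S := Valuation.Continues.irrefl S.1
  have : Nonempty X := ⟨fun _ => 0, fun n => by simp⟩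
  refine false_of_forall_chain_exists_rel (r := r) htrans hirrefl (fun S => ?_)
    (fun c _ _ _ hlt => ?_)
  · have h := Valuation.continues_add_exp (f := f) (w := w) (x := x) S.1
    exact ⟨⟨_, h.isPartialSum hw hf hx S.2⟩, h⟩
  · obtain ⟨T, hT⟩ := Valuation.IsPartialSum.exists_continues hw hf hwt hmax hx
      (S := fun S : c => S.1.1) (fun S => S.1.2) hlt
    -- The limit inherits the bounds of a partial sum from any member of the chain that it
    -- continues.
    obtain ⟨S⟩ := ‹Nonempty c›
    exact ⟨⟨T, (hT S).isPartialSum hw hf hx S.1.2⟩, hT⟩
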